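/- Let $d$ be a positive integer and let $(R,\mathfrak m,k)$ be a $d$-dimensional regular local ring with infinite residue field $k$ and field of fractions $K$, and let $I$ be an $\mathfrak m$-primary ideal of $R$. For a nonzero ideal $\mathfrak a$ of a Noetherian domain $A$ with field of fractions $K$, let $\mathrm{Rees}_A\,\mathfrak a$ (the set of Rees valuation rings of $\mathfrak a$, which we identify with the set of Rees valuations, i.e. the corresponding valuations with value group $\mathbb Z$) be the set of discrete valuation rings of the form $\big(\overline{A[\mathfrak a/a]}\big)_Q$, where $0\neq a\in\mathfrak a$, where $\overline{A[\mathfrak a/a]}$ is the integral closure of $A[\mathfrak a/a]$ in $K$, and where $Q$ is a prime ideal of $\overline{A[\mathfrak a/a]}$ of height one with $\mathfrak a\subseteq Q$. Let $x\in\mathfrak m\setminus\mathfrak m^2$ be such that $xV=\mathfrak mV$ for every $V\in\mathrm{Rees}_R\,I$, and put $S_1=R[\mathfrak m/x]\subseteq K$. Let $r=\mathrm{ord}_R(I)$ be the largest integer with $I\subseteq\mathfrak m^r$, and let $I_1$ be the transform of $I$ in $S_1$, i.e. the ideal of $S_1$ with $IS_1=x^rI_1$. Suppose that every $V\in\mathrm{Rees}_R\,I$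 is centered on a maximal ideal of $S_1$ (that is, $S_1\subseteq V$ and the intersection of $S_1$ with the maximal ideal of $V$ is a maximal ideal of $S_1$), and that $\dim(S_1/I_1)>0$. Then there is a Rees valuation of $I_1$ that is not a Rees valuation of $I$, i.e. $\mathrm{Rees}_{S_1}I_1\nsubseteq\mathrm{Rees}_R\,I$. -/

import Mathlib

open IsLocalRing

namespace ReesVal

noncomputable section

/-- For an ideal `I` of a domain `A` with field of fractions `K` and an element `a` of `A`, the
`A`-subalgebra `A[I/a]` of `K` generated by the fractions `b / a` with `b ∈ I`. -/
def affineBlowup {A : Type*} [CommRing A] (K : Type*) [Field K] [Algebra A K]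
    (I : Ideal A) (a : A) : Subalgebra A K :=
  Algebra.adjoin A {z : K | ∃ b ∈ I, z = algebraMap A K b / algebraMap A K a}

/-- The integral closure, in the field of fractions `K`, of the ring `A[I/a]`. -/
abbrev normalizedBlowup {A : Type*} [CommRing A] (K : Type*) [Field K] [Algebra A K]
    (I : Ideal A) (a : A) : Subalgebra (affineBlowup K I a) K :=
  integralClosure (affineBlowup K I a) K

/-- The Rees valuation rings of an ideal `I` of a domain `A` with field of fractions `K`:
the discrete valuation rings of the form `B_Q`, where `B` is the integral closure of `A[I/a]` in
`K` for some nonzero `a ∈ I`, and `Q` is a prime ideal of `B` of height one that contains `I`.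
A Rees valuation is determined by its valuation ring and conversely, so that the same set
stands for the set of Rees valuations. -/
def reesValuationRings {A : Type*} [CommRing A] (K : Type*) [Field K] [Algebra A K]
    (I : Ideal A) : Set (ValuationSubring K) :=
  {V | IsDiscreteValuationRing V ∧
    ∃ a ∈ I, a ≠ 0 ∧
      ∃ Q : Ideal (normalizedBlowup K I a), Q.IsPrime ∧ Q.height = 1 ∧
        (∀ b ∈ I, algebraMap (affineBlowup K I a) (normalizedBlowup K I a)
          (algebraMap A (affineBlowup K I a) b) ∈ Q) ∧
        (V : Set K) = {z : K | ∃ b s : normalizedBlowup K I a, s ∉ Q ∧ z = (b : K) / (s : K)}}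

/-- The valuation ring `V` of `K` contains (the image of) `A`, and the prime ideal `P` of `A`
is the center `m(V) ∩ A` of `V` on `A`. The maximal ideal `m(V)` is the set of nonunits
of `V`. -/
def IsCenter {A : Type*} [CommRing A] {K : Type*} [Field K] [Algebra A K]
    (V : ValuationSubring K) (P : Ideal A) : Prop :=
  (∀ s : A, algebraMap A K s ∈ V) ∧ ∀ s : A, s ∈ P ↔ algebraMap A K s ∈ V.nonunits

/-- The order `ord_R I` of an ideal of a local ring: the largest `r` with `I ⊆ m ^ r`. -/
def idealOrd {R : Type*} [CommRing R] [IsLocalRing R] (I : Ideal R) : ℕ :=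
  sSup {n : ℕ | I ≤ maximalIdeal R ^ n}

/-- The ring `S₁ = R[m/x]`, as an `R`-subalgebra of the field of fractions `K` of `R`. -/
abbrev firstBlowup {R : Type*} [CommRing R] [IsLocalRing R] (K : Type*) [Field K] [Algebra R K]
    (x : R) : Subalgebra R K :=
  affineBlowup K (maximalIdeal R) x

/-- The transform `I₁ = x⁻ʳ I S₁` of `I` in `S₁ = R[m/x]`, where `r = ord_R I`. -/
def firstTransform {R : Type*} [CommRing R] [IsLocalRing R] (K : Type*) [Field K] [Algebra R K]
    (x : R) (I : Ideal R) : Ideal (firstBlowup K x) where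
  carrier := {s | algebraMap R (firstBlowup K x) x ^ idealOrd I * s ∈
    I.map (algebraMap R (firstBlowup K x))}
  add_mem' := by
    intro s t hs ht
    simp only [Set.mem_ofPred_eq] at hs ht ⊢
    rw [mul_add]
    exact Ideal.add_mem _ hs ht
  zero_mem' := by simp
  smul_mem' := by
    intro c s hs
    simp only [Set.mem_ofPred_eq, smul_eq_mul] at hs ⊢
    rw [mul_left_comm]
    exact Ideal.mul_mem_left _ _ hs

theorem mem_firstTransform {R : Type*} [CommRing R] [IsLocalRing R] (K : Type*) [Field K]
    [Algebra R K] (x : R) (I : Ideal R) (s : firstBlowup K x) :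
    s ∈ firstTransform K x I ↔ algebraMap R (firstBlowup K x) x ^ idealOrd I * s ∈
      I.map (algebraMap R (firstBlowup K x)) :=
  Iff.rfl

theorem le_pow_idealOrd {R : Type*} [CommRing R] [IsLocalRing R] (I : Ideal R) :
    I ≤ maximalIdeal R ^ idealOrd I := by
  by_cases h : BddAbove {n : ℕ | I ≤ maximalIdeal R ^ n}
  · exact Nat.sSup_mem (s := {n : ℕ | I ≤ maximalIdeal R ^ n}) ⟨0, by simp⟩ h
  · have h0 : idealOrd I = 0 := Nat.sSup_of_not_bddAbove h
    rw [h0]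
    simp

/-- The defining property of the transform: `I S₁ = xʳ I₁` with `r = ord_R I`. -/
theorem map_eq_span_mul_firstTransform {R : Type*} [CommRing R] [IsLocalRing R]
    (K : Type*) [Field K] [Algebra R K] [IsFractionRing R K] (x : R) (hx : x ≠ 0) (I : Ideal R) :
    I.map (algebraMap R (firstBlowup K x)) =
      Ideal.span {algebraMap R (firstBlowup K x) x ^ idealOrd I} * firstTransform K x I := by
  have hxK : algebraMap R K x ≠ 0 := fun h =>
    hx (IsFractionRing.injective R K (by rw [h, map_zero]))
  have h1 : (maximalIdeal R).map (algebraMap R (firstBlowup K x)) ≤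
      Ideal.span {algebraMap R (firstBlowup K x) x} := by
    rw [Ideal.map_le_iff_le_comap]
    intro y hy
    rw [Ideal.mem_comap, Ideal.mem_span_singleton']
    refine ⟨⟨algebraMap R K y / algebraMap R K x, Algebra.subset_adjoin ⟨y, hy, rfl⟩⟩, ?_⟩
    apply Subtype.ext
    change algebraMap R K y / algebraMap R K x * algebraMap R K x = algebraMap R K y
    field_simp
  have h2 : I.map (algebraMap R (firstBlowup K x)) ≤
      Ideal.span {algebraMap R (firstBlowup K x) x ^ idealOrd I} := by
    rw [← Ideal.span_singleton_pow]
    refine le_trans ?_ (Ideal.pow_right_mono h1 _)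
    rw [← Ideal.map_pow]
    exact Ideal.map_mono (le_pow_idealOrd I)
  ext s
  rw [Ideal.mem_span_singleton_mul]
  constructor
  · intro hs
    obtain ⟨t, ht⟩ := Ideal.mem_span_singleton'.1 (h2 hs)
    rw [mul_comm] at ht
    refine ⟨t, ?_, ht⟩
    rw [mem_firstTransform, ht]
    exact hs
  · rintro ⟨t, ht, rfl⟩
    exact (mem_firstTransform K x I t).1 ht

end

end ReesVal

/-! Since `S₁/I₁` has positive dimension, some minimal prime `P` of `I₁` is not maximal. By
`exists_reesValuationRing_isCenter`, `P` is the center of a Rees valuation of `I₁`. The Rees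
valuations of `I` have maximal centers on `S₁`, and centers are unique, so this valuation is a new
one.

To realize a minimal prime `P` of `J` as a center, take a valuation ring `W` centered on `P` and `a
∈ J` of least `W`-value. Then `C = A[J/a] ⊆ W` and `JC = aC`. A minimal prime `q` of `aC` inside the
center of `W` has height one by Krull's principal ideal theorem, and it contracts to `P` by
minimality. Above `q` lies a discrete valuation ring of the integral closure of `C`
(`exists_discreteValuationRing_of_height_eq_one`). That closure need not be finite over `C`, hence
the use of Krull–Akizuki. -/

namespace ReesVal

/-! ### Krull–Akizuki for birational extensions of a local domain. -/

/-- In a one-dimensional Noetherian domain, all quotients by nonzero elements are Artinian. -/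
theorem isArtinianRing_quotient_span_singleton {D : Type*} [CommRing D] [IsDomain D]
    [IsNoetherianRing D] [Ring.DimensionLEOne D] {b : D} (hb : b ≠ 0) :
    IsArtinianRing (D ⧸ Ideal.span {b}) := by
  rw [isArtinianRing_iff_isNoetherianRing_krullDimLE_zero]
  refine ⟨inferInstance, Ring.KrullDimLE.mk₀ fun P hP => ?_⟩
  have hbP : Ideal.Quotient.mk (Ideal.span {b}) b ∈ P := by
    rw [Ideal.Quotient.eq_zero_iff_mem.2 (Ideal.mem_span_singleton_self b)]
    exact P.zero_mem
  have hmax : (P.comap (Ideal.Quotient.mk (Ideal.span {b}))).IsMaximal :=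
    Ideal.IsPrime.isMaximal inferInstance fun h => hb (by
      have : b ∈ P.comap (Ideal.Quotient.mk (Ideal.span {b})) := hbP
      rwa [h, Ideal.mem_bot] at this)
  rw [← Ideal.map_comap_of_surjective _ Ideal.Quotient.mk_surjective P]
  exact (Ideal.map_eq_top_or_isMaximal_of_surjective _ Ideal.Quotient.mk_surjective
    hmax).resolve_left fun h => hP.ne_top (by
      rwa [Ideal.map_comap_of_surjective _ Ideal.Quotient.mk_surjective] at h)

/-- In a one-dimensional local domain, every nonunit has a power divisible by a given
nonzero element. -/
theorem exists_dvd_pow_of_mem_maximalIdeal {D : Type*} [CommRing D] [IsDomain D]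
    [IsLocalRing D] [Ring.DimensionLEOne D] {b s : D} (hb : b ∈ maximalIdeal D) (hs : s ≠ 0) :
    ∃ n : ℕ, s ∣ b ^ n := by
  have h : b ∈ (Ideal.span {s}).radical := by
    rw [Ideal.radical_eq_sInf, Submodule.mem_sInf]
    rintro P ⟨hsP, hP⟩
    have hP0 : P ≠ ⊥ := fun h => hs (by
      have := hsP (Ideal.mem_span_singleton_self s)
      rwa [h, Ideal.mem_bot] at this)
    rwa [IsLocalRing.eq_maximalIdeal (hP.isMaximal hP0)]
  obtain ⟨n, hn⟩ := h
  exact ⟨n, Ideal.mem_span_singleton.1 hn⟩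

section KrullAkizuki

variable {D : Type*} [CommRing D] [IsDomain D] [IsNoetherianRing D] [IsLocalRing D]
  [Ring.DimensionLEOne D] {K : Type*} [Field K] [Algebra D K] [IsFractionRing D K]

/-- The ideals `bᵐE ∩ D` decrease, and their images in the Artinian ring `D/bD` stabilize at some
`n`. This makes one exponent serve every `e`, although the denominators of the `e` are unbounded. -/
theorem exists_pow_mul_eq_algebraMap_add (E : Subalgebra D K) {b : D} (hb0 : b ≠ 0)
    (hb : b ∈ maximalIdeal D) :
    ∃ n : ℕ, ∀ e : E, ∃ (d : D) (e' : E),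
      algebraMap D E b ^ n * e = algebraMap D E d + algebraMap D E b ^ (n + 1) * e' := by
  have hbK : algebraMap D K b ≠ 0 := fun h => hb0 (IsFractionRing.injective D K (by rw [h, map_zero]))
  have hbE : algebraMap D E b ≠ 0 := fun h => hbK (congrArg (algebraMap E K) h)
  have := isArtinianRing_quotient_span_singleton hb0
  let J : ℕ → Ideal D := fun m => (Ideal.span {algebraMap D E b ^ m}).comap (algebraMap D E)
  have hJ : Antitone J := fun m n h => Ideal.comap_mono <| by
    rw [Ideal.span_singleton_le_span_singleton]
    exact pow_dvd_pow _ h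
  obtain ⟨n, hn⟩ := IsArtinian.monotone_stabilizes (R := D ⧸ Ideal.span {b})
    (M := D ⧸ Ideal.span {b})
    ⟨fun m => OrderDual.toDual ((J m).map (Ideal.Quotient.mk (Ideal.span {b}))),
      fun m n h => Ideal.map_mono (hJ h)⟩
  have hn' : ∀ m, n ≤ m → (J n).map (Ideal.Quotient.mk (Ideal.span {b})) =
    (J m).map (Ideal.Quotient.mk (Ideal.span {b})) := fun m hm => hn m hm
  have hstep : ∀ m, n ≤ m → ∀ d ∈ J m, ∃ d' ∈ J (m + 1), ∃ c, d = d' + c * b := by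
    intro m hm d hd
    have h : Ideal.Quotient.mk (Ideal.span {b}) d ∈
        (J (m + 1)).map (Ideal.Quotient.mk (Ideal.span {b})) := by
      rw [← hn' (m + 1) (by lia), hn' m hm]
      exact Ideal.mem_map_of_mem _ hd
    obtain ⟨d', hd', h'⟩ := (Ideal.mem_map_iff_of_surjective _ Ideal.Quotient.mk_surjective).1 h
    obtain ⟨c, hc⟩ := Ideal.mem_span_singleton'.1 (Ideal.Quotient.eq.1 h'.symm)
    exact ⟨d', hd', c, by rw [hc]; ring⟩
  refine ⟨n, fun e => ?_⟩
  -- For large `m`, depending on `e`, a denominator of `e` divides `bᵐ`, so `e' = 0` will do. The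
  -- induction then lowers `m` to `0`.
  have hex : ∃ m : ℕ, ∃ (d : D) (e' : E),
      algebraMap D E b ^ (n + m) * e = algebraMap D E d + algebraMap D E b ^ (n + m + 1) * e' := by
    obtain ⟨c, s, hs, hcs⟩ := IsFractionRing.div_surjective (A := D) (e : K)
    have hs0 : s ≠ 0 := nonZeroDivisors.ne_zero hs
    have hsK : algebraMap D K s ≠ 0 :=
      fun h => hs0 (IsFractionRing.injective D K (by rw [h, map_zero]))
    obtain ⟨m, t, ht⟩ := exists_dvd_pow_of_mem_maximalIdeal hb hs0
    refine ⟨m, b ^ n * t * c, 0, Subtype.ext ?_⟩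
    change algebraMap D K b ^ (n + m) * (e : K) =
      algebraMap D K (b ^ n * t * c) + algebraMap D K b ^ (n + m + 1) * 0
    rw [← hcs, pow_add, ← map_pow _ b m, ht]
    simp only [map_mul, map_pow]
    field_simp
    ring
  obtain ⟨m, hm⟩ := hex
  induction m with
  | zero => simpa using hm
  | succ m ih =>
    refine ih ?_
    obtain ⟨d, e', h⟩ := hm
    -- The relation puts `d` in `bⁿ⁺ᵐ⁺¹E`. Stability replaces it, modulo `bD`, by an element of
    -- `bⁿ⁺ᵐ⁺²E`, and one factor `b` cancels.
    have hd : d ∈ J (n + (m + 1)) := by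
      rw [Ideal.mem_comap, Ideal.mem_span_singleton']
      exact ⟨e - algebraMap D E b * e', by rw [sub_mul, mul_comm e, h]; ring⟩
    obtain ⟨d', hd', c, rfl⟩ := hstep _ (by lia) d hd
    obtain ⟨e'', he''⟩ := Ideal.mem_span_singleton'.1 (Ideal.mem_comap.1 hd')
    refine ⟨c, e' + e'', mul_left_cancel₀ hbE ?_⟩
    rw [map_add, ← he'', map_mul] at h
    linear_combination h

/-- The birational case of the Krull–Akizuki theorem, over a local base ring. -/
theorem isNoetherianRing_of_dimensionLEOne (E : Subalgebra D K) : IsNoetherianRing E := by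
  rw [isNoetherianRing_iff_ideal_fg]
  intro L
  by_cases hL : L = ⊥
  · exact hL ▸ Submodule.fg_bot
  obtain ⟨e, heL, he0⟩ := Submodule.exists_mem_ne_zero_of_ne_bot hL
  obtain ⟨b, s, hs, hbs⟩ := IsFractionRing.div_surjective (A := D) (e : K)
  have hsK : algebraMap D K s ≠ 0 := fun h =>
    nonZeroDivisors.ne_zero hs (IsFractionRing.injective D K (by rw [h, map_zero]))
  have hse : algebraMap D E b = algebraMap D E s * e := Subtype.ext <| by
    change algebraMap D K b = algebraMap D K s * (e : K)
    rw [← hbs]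
    field_simp
  have hbL : algebraMap D E b ∈ L := hse ▸ L.mul_mem_left _ heL
  have hb0 : b ≠ 0 := by
    rintro rfl
    exact he0 (Subtype.ext (by simpa using hbs.symm))
  by_cases hb : b ∈ maximalIdeal D
  swap
  · have : IsUnit b := by simpa using hb
    rw [Ideal.eq_top_of_isUnit_mem L hbL (this.map _)]
    exact (⟨{1}, by simp⟩ : (⊤ : Ideal E).FG)
  obtain ⟨n, hn⟩ := exists_pow_mul_eq_algebraMap_add E hb0 hb
  have hbE : algebraMap D E b ^ n ≠ 0 := pow_ne_zero _ fun h =>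
    hb0 (IsFractionRing.injective D K ((congrArg (algebraMap E K) h).trans (map_zero _).symm))
  -- It suffices to generate `bⁿL`. It contains `bⁿ⁺¹E` because `b ∈ L`, and modulo `bⁿ⁺¹E` each of
  -- its elements comes from `D`. So `bⁿ⁺¹` and the contraction to the Noetherian ring `D` generate
  -- it.
  refine Submodule.fg_of_fg_map_injective (LinearMap.mulLeft E (algebraMap D E b ^ n))
    (fun u v h => mul_left_cancel₀ hbE h) ?_
  set L' : Ideal E := Submodule.map (LinearMap.mulLeft E (algebraMap D E b ^ n)) L
  have hL'eq : L' = (L'.comap (algebraMap D E)).map (algebraMap D E) ⊔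
      Ideal.span {algebraMap D E b ^ (n + 1)} := by
    have hmem : ∀ l ∈ L, algebraMap D E b ^ n * l ∈ L' := fun l hl => ⟨l, hl, rfl⟩
    have hb' : ∀ e : E, algebraMap D E b ^ (n + 1) * e ∈ L' := fun e => by
      have := hmem _ (L.mul_mem_right e hbL)
      rwa [← mul_assoc, ← pow_succ] at this
    refine le_antisymm ?_ (sup_le Ideal.map_comap_le ?_)
    · rintro _ ⟨l, hl, rfl⟩
      obtain ⟨d, e', h⟩ := hn l
      rw [LinearMap.mulLeft_apply, h]
      refine Submodule.add_mem_sup (Ideal.mem_map_of_mem _ ?_)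
        (Ideal.mul_mem_right _ _ (Ideal.mem_span_singleton_self _))
      rw [Ideal.mem_comap, eq_sub_of_add_eq h.symm]
      exact L'.sub_mem (hmem _ hl) (hb' _)
    · rw [Ideal.span_singleton_le_iff_mem]
      simpa using hb' 1
  rw [hL'eq]
  exact Submodule.FG.sup (Ideal.FG.map (IsNoetherian.noetherian _) _)
    ⟨{algebraMap D E b ^ (n + 1)}, by simp [Ideal.span]⟩

end KrullAkizuki

/-! ### Discrete valuation rings above primes of height one. -/

theorem dimensionLEOne_of_height_le_one {C : Type*} [CommRing C] [IsDomain C] (q : Ideal C)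
    [q.IsPrime] (hq : q.height ≤ 1) (D : Type*) [CommRing D] [IsDomain D] [Algebra C D]
    [IsLocalization.AtPrime D q] : Ring.DimensionLEOne D where
  maximalOfPrime {P} hP0 hP := by
    have := IsLocalization.AtPrime.isLocalRing D q
    have hle : P.comap (algebraMap C D) ≤ q := by
      rw [← IsLocalization.AtPrime.under_maximalIdeal D q]
      exact Ideal.comap_mono (le_maximalIdeal hP.ne_top)
    have hne : P.comap (algebraMap C D) ≠ ⊥ := fun h => hP0 <| by
      rw [← IsLocalization.map_under q.primeCompl D P, Ideal.under, h, Ideal.map_bot]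
    have heq : P.comap (algebraMap C D) = q := by
      by_contra h
      have h1 := Ideal.height_add_one_le_of_lt_of_isPrime (lt_of_le_of_ne hle h)
      have h2 := Ideal.height_add_one_le_of_lt_of_isPrime (bot_lt_iff_ne_bot.2 hne)
      have h3 : (1 : ℕ∞) + 1 ≤ 1 :=
        (add_le_add_left (le_add_self.trans h2) 1).trans (h1.trans hq)
      exact absurd h3 (by decide)
    have : P = maximalIdeal D := by
      rw [← IsLocalization.map_under q.primeCompl D P, Ideal.under, heq,
        IsLocalization.AtPrime.map_eq_maximalIdeal q D]
    exact this ▸ inferInstance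

/-- A prime of an integral extension of domains lying over a prime of height one has
height one. -/
theorem height_eq_one_of_isIntegral {C B : Type*} [CommRing C] [IsDomain C] [CommRing B]
    [IsDomain B] [Algebra C B] [Algebra.IsIntegral C B]
    (hinj : Function.Injective (algebraMap C B)) (Q : Ideal B) [Q.IsPrime]
    (hQ : (Q.comap (algebraMap C B)).height = 1) : Q.height = 1 := by
  have hQ0 : ⊥ < Q := bot_lt_iff_ne_bot.2 fun h => by
    rw [h, Ideal.comap_bot_of_injective _ hinj, Ideal.height_bot] at hQ
    exact zero_ne_one hQ
  refine le_antisymm (Ideal.height_le_iff.2 fun P hP hPQ => ?_) ?_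
  · have h := Ideal.height_add_one_le_of_lt_of_isPrime (Ideal.IsIntegral.comap_lt_comap (R := C) hPQ)
    rw [hQ] at h
    have h0 : (P.comap (algebraMap C B)).height = 0 := by
      refine Order.lt_one_iff.1 (lt_of_not_ge fun h1 => ?_)
      exact absurd ((add_le_add_left h1 1).trans h) (by decide)
    rw [Ideal.height_eq_zero_iff_eq_bot] at h0
    rw [Ideal.eq_bot_of_comap_eq_bot h0, Ideal.height_bot]
    exact zero_lt_one
  · have h := Ideal.height_add_one_le_of_lt_of_isPrime hQ0
    exact le_add_self.trans h

theorem mem_nonunits_iff_of_eq {K : Type*} [Field K] {C : Type*} [CommRing C] [Algebra C K]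
    {B : Subalgebra C K} {Q : Ideal B} {V : ValuationSubring K}
    (hV : (V : Set K) = {z : K | ∃ b s : B, s ∉ Q ∧ z = (b : K) / (s : K)}) (b : B) :
    (b : K) ∈ V.nonunits ↔ b ∈ Q := by
  have hmem : ∀ z : K, z ∈ V ↔ ∃ b s : B, s ∉ Q ∧ z = (b : K) / (s : K) := fun z => by
    rw [← SetLike.mem_coe, hV]; rfl
  rw [ValuationSubring.mem_nonunits_iff_or, hmem]
  constructor
  · rintro (h | h)
    · rw [Subtype.ext (a1 := b) (a2 := 0) h]
      exact Q.zero_mem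
    · by_contra hb
      exact h ⟨1, b, hb, by simp⟩
  · intro hb
    refine or_iff_not_imp_left.2 fun h0 => ?_
    rintro ⟨c, s, hs, h⟩
    have hs0 : (s : K) ≠ 0 := fun h => hs (by
      rw [Subtype.ext (a1 := s) (a2 := 0) h]
      exact Q.zero_mem)
    refine hs ?_
    have : s = b * c := Subtype.ext <| by
      change (s : K) = b * c
      field_simp at h
      exact h
    rw [this]
    exact Q.mul_mem_right _ hb

theorem isDiscreteValuationRing_valuationSubringAtPrime {E : Type*} [CommRing E]
    [IsDedekindDomain E] {K : Type*} [Field K] [Algebra E K] [IsFractionRing E K]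
    (v : IsDedekindDomain.HeightOneSpectrum E) :
    IsDiscreteValuationRing (v.valuationSubringAtPrime K) :=
  have : IsLocalization.AtPrime (v.valuationSubringAtPrime K) v.asIdeal :=
    inferInstanceAs (IsLocalization v.asIdeal.primeCompl (v.valuationSubringAtPrime K))
  IsLocalization.AtPrime.isDiscreteValuationRing_of_dedekind_domain E v.ne_bot
    (v.valuationSubringAtPrime K)

/-- Every prime `q` of height one of a Noetherian domain `C` is the center of a discrete valuation
ring that is the localization of the integral closure of `C` at a prime of height one. -/
theorem exists_discreteValuationRing_of_height_eq_one {C : Type*} [CommRing C] [IsDomain C]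
    [IsNoetherianRing C] {K : Type*} [Field K] [Algebra C K] [IsFractionRing C K]
    (q : Ideal C) [q.IsPrime] (hq : q.height = 1) :
    ∃ V : ValuationSubring K, IsDiscreteValuationRing V ∧
      ∃ Q : Ideal (integralClosure C K), Q.IsPrime ∧ Q.height = 1 ∧
        Q.comap (algebraMap C (integralClosure C K)) = q ∧
        (V : Set K) = {z : K | ∃ b s : integralClosure C K, s ∉ Q ∧ z = (b : K) / (s : K)} := by
  -- `D` is `C_q` inside `K`. Its integral closure `E` is Dedekind by Krull–Akizuki, and `V` is
  -- `E_N` for any maximal ideal `N`.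
  let D := Localization.subalgebra.ofField K q.primeCompl q.primeCompl_le_nonZeroDivisors
  have hloc : IsLocalization.AtPrime D q :=
    Localization.subalgebra.isLocalization_ofField K q.primeCompl _
  have : IsLocalRing D := IsLocalization.AtPrime.isLocalRing D q
  have : IsNoetherianRing D := IsLocalization.isNoetherianRing q.primeCompl D inferInstance
  have : IsFractionRing D K :=
    Localization.subalgebra.isFractionRing_ofField K q.primeCompl _
  have : Ring.DimensionLEOne D := dimensionLEOne_of_height_le_one q hq.le D
  let E := integralClosure D K
  have : IsNoetherianRing E := isNoetherianRing_of_dimensionLEOne E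
  have : Algebra.IsAlgebraic D K := IsLocalization.isAlgebraic K (nonZeroDivisors D)
  have : IsFractionRing E K := integralClosure.isFractionRing_of_algebraic (A := D) (L := K)
    (fun x hx => IsFractionRing.injective D K (by rw [hx, map_zero]))
  have : IsIntegrallyClosed E :=
    (isIntegrallyClosed_iff_isIntegrallyClosedIn K).2 inferInstance
  have : IsDedekindDomain E := {}
  have hDE : Function.Injective (algebraMap D E) := fun a b h =>
    IsFractionRing.injective D K (congrArg (algebraMap E K) h)
  obtain ⟨N, hN⟩ := Ideal.exists_maximal E
  have hND : N.comap (algebraMap D E) = maximalIdeal D :=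
    IsLocalRing.eq_maximalIdeal (Ideal.isMaximal_comap_of_isIntegral_of_isMaximal N)
  have hq0 : q ≠ ⊥ := Ideal.ne_bot_of_height_eq_one hq
  have hN0 : N ≠ ⊥ := by
    rintro rfl
    rw [Ideal.comap_bot_of_injective _ hDE] at hND
    refine hq0 ?_
    rw [← IsLocalization.AtPrime.under_maximalIdeal D q, ← hND]
    exact Ideal.comap_bot_of_injective _ (FaithfulSMul.algebraMap_injective C D)
  let v : IsDedekindDomain.HeightOneSpectrum E := ⟨N, hN.isPrime, hN0⟩
  let B := integralClosure C K
  let f : B →+* E := (algebraMap B K).codRestrict E fun b => b.2.tower_top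
  have hfC : f.comp (algebraMap C B) = (algebraMap D E).comp (algebraMap C D) := rfl
  have hQq : (N.comap f).comap (algebraMap C B) = q := by
    rw [Ideal.comap_comap, hfC, ← Ideal.comap_comap, hND]
    exact IsLocalization.AtPrime.under_maximalIdeal D q
  have hQ : (N.comap f).IsPrime := inferInstance
  refine ⟨v.valuationSubringAtPrime K, ?_, N.comap f, hQ,
    height_eq_one_of_isIntegral (C := C) (B := B)
      (FaithfulSMul.algebraMap_injective C B) _ (by rw [hQq, hq]), hQq, ?_⟩
  · exact isDiscreteValuationRing_valuationSubringAtPrime v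
  -- Elements of `E` become integral over `C` after multiplication by some `c ∉ q`. Hence `E_N` is
  -- already the localization of `B` at `N ∩ B`.
  have hfrac : ∀ e : E, ∃ (c : C) (b : B), c ∉ q ∧ algebraMap C K c * (e : K) = b := by
    intro e
    obtain ⟨m, hm⟩ := IsIntegral.exists_multiple_integral_of_isLocalization q.primeCompl
      (Rₘ := D) (e : K) e.2
    exact ⟨m, ⟨_, hm⟩, m.2, by rw [← Algebra.smul_def]; rfl⟩
  ext z
  constructor
  · rintro ⟨e, t, ht, rfl⟩
    obtain ⟨c, b, hc, hb⟩ := hfrac e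
    obtain ⟨c', b', hc', hb'⟩ := hfrac t
    have hmem : ∀ c, algebraMap C B c ∈ N.comap f ↔ c ∈ q := fun c => by
      rw [← Ideal.mem_comap, hQq]
    have hne : ∀ c, c ∉ q → algebraMap C K c ≠ 0 := fun c hc h => hc <| by
      rw [IsFractionRing.injective C K (h.trans (map_zero _).symm)]
      exact q.zero_mem
    have htK : (t : K) ≠ 0 := fun h => ht (by
      rw [Subtype.ext (a1 := t) (a2 := 0) h]
      exact N.zero_mem)
    have hb'N : b' ∉ N.comap f := by
      have : f b' = f (algebraMap C B c') * t := Subtype.ext hb'.symm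
      rw [Ideal.mem_comap, this, hN.isPrime.mul_mem_iff_mem_or_mem, not_or]
      exact ⟨fun h => hc' ((hmem c').1 h), ht⟩
    refine ⟨b * algebraMap C B c', b' * algebraMap C B c, ?_, ?_⟩
    · rw [hQ.mul_mem_iff_mem_or_mem, hmem, not_or]
      exact ⟨hb'N, hc⟩
    · change algebraMap E K e * (algebraMap E K t)⁻¹ =
        (b * algebraMap C K c' : K) / (b' * algebraMap C K c : K)
      change (e : K) * (t : K)⁻¹ = _
      rw [← hb, ← hb']
      have := hne c hc
      have := hne c' hc'
      field_simp
  · rintro ⟨b, s, hs, rfl⟩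
    exact ⟨f b, f s, hs, div_eq_mul_inv _ _⟩

/-! ### Minimal primes as centers of Rees valuations. -/

theorem isFractionRing_subalgebra {A : Type*} [CommRing A] {K : Type*} [Field K] [Algebra A K]
    [IsFractionRing A K] (C : Subalgebra A K) : IsFractionRing C K :=
  IsFractionRing.of_field C K fun z => by
    obtain ⟨a, s, -, h⟩ := IsFractionRing.div_surjective (A := A) z
    exact ⟨algebraMap A C a, algebraMap A C s, h.symm⟩

theorem isNoetherianRing_affineBlowup {A : Type*} [CommRing A] [IsNoetherianRing A] {K : Type*}
    [Field K] [Algebra A K] (J : Ideal A) (a : A) : IsNoetherianRing (affineBlowup K J a) := by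
  obtain ⟨S, hS⟩ := IsNoetherian.noetherian J
  have hfg : (affineBlowup K J a).FG := by
    classical
    refine ⟨S.image fun b => algebraMap A K b / algebraMap A K a, le_antisymm ?_ ?_⟩
    · refine Algebra.adjoin_mono ?_
      intro z hz
      obtain ⟨b, hb, rfl⟩ := Finset.mem_image.1 hz
      exact ⟨b, hS ▸ Submodule.subset_span hb, rfl⟩
    · refine Algebra.adjoin_le ?_
      rintro _ ⟨b, hb, rfl⟩
      rw [← hS] at hb
      induction hb using Submodule.span_induction with
      | mem b hb => exact Algebra.subset_adjoin (Finset.mem_image_of_mem _ hb)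
      | zero => simp
      | add b c _ _ hb hc =>
        rw [map_add, add_div]
        exact add_mem hb hc
      | smul r b _ hb =>
        rw [smul_eq_mul, map_mul, mul_div_assoc]
        exact mul_mem (Subalgebra.algebraMap_mem _ r) hb
  have := (affineBlowup K J a).fg_iff_finiteType.1 hfg
  exact Algebra.FiniteType.isNoetherianRing A _

/-- Every prime ideal of a domain is the center of a valuation ring of the field of fractions. -/
theorem exists_valuationSubring_isCenter {A : Type*} [CommRing A] [IsDomain A] {K : Type*}
    [Field K] [Algebra A K] [IsFractionRing A K] (P : Ideal A) [P.IsPrime] :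
    ∃ W : ValuationSubring K, IsCenter W P := by
  let D := Localization.subalgebra.ofField K P.primeCompl P.primeCompl_le_nonZeroDivisors
  have hloc : IsLocalization.AtPrime D P :=
    Localization.subalgebra.isLocalization_ofField K P.primeCompl _
  have : IsLocalRing D := IsLocalization.AtPrime.isLocalRing D P
  -- Dominating the localization `D` at `P`, and not just containing `A`, makes the center exactly
  -- `P`: elements outside `P` are units of `D`.
  obtain ⟨W, hDW, hW⟩ := Ideal.image_subset_nonunits_valuationSubring (A := D.toSubring)
    (maximalIdeal D) (Ideal.IsMaximal.ne_top inferInstance)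
  refine ⟨W, fun s => hDW (D.algebraMap_mem s), fun s => ⟨fun hs => ?_, fun hs => ?_⟩⟩
  · exact hW ⟨algebraMap A D s,
      (IsLocalization.AtPrime.to_map_mem_maximal_iff D P s).2 hs, rfl⟩
  · by_contra hsP
    rcases W.mem_nonunits_iff_or.1 hs with h | h
    · refine hsP ?_
      rw [IsFractionRing.injective A K (h.trans (map_zero _).symm)]
      exact P.zero_mem
    · exact h (hDW ⟨1, s, hsP, by simp⟩)

theorem IsCenter.eq {A : Type*} [CommRing A] {K : Type*} [Field K] [Algebra A K]
    {V : ValuationSubring K} {P Q : Ideal A} (hP : IsCenter V P) (hQ : IsCenter V Q) : P = Q :=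
  Ideal.ext fun s => (hP.2 s).trans (hQ.2 s).symm

/-- If the ideal `J` is finitely generated, it has an element of least value in a given
valuation ring. -/
theorem exists_forall_valuation_le {A : Type*} [CommRing A] {K : Type*} [Field K] [Algebra A K]
    [IsFractionRing A K] (W : ValuationSubring K) (hW : ∀ s : A, algebraMap A K s ∈ W)
    {J : Ideal A} (hJ : J.FG) (hJ0 : J ≠ ⊥) :
    ∃ a ∈ J, a ≠ 0 ∧
      ∀ b ∈ J, W.valuation (algebraMap A K b) ≤ W.valuation (algebraMap A K a) := by
  obtain ⟨S, hS⟩ := hJ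
  have hSne : S.Nonempty := by
    rw [Finset.nonempty_iff_ne_empty]
    rintro rfl
    exact hJ0 (by rw [← hS]; simp)
  -- Valuations are multiplicative here, so least value means a maximum.
  obtain ⟨a, haS, ha⟩ := S.exists_max_image (fun s => W.valuation (algebraMap A K s)) hSne
  have hle : ∀ b ∈ J, W.valuation (algebraMap A K b) ≤ W.valuation (algebraMap A K a) := by
    intro b hb
    rw [← hS] at hb
    induction hb using Submodule.span_induction with
    | mem b hb => exact ha b hb
    | zero => simp
    | add b c _ _ hb hc =>
      rw [map_add]
      exact (W.valuation.map_add _ _).trans (max_le hb hc)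
    | smul r b _ hb =>
      rw [smul_eq_mul, map_mul, map_mul]
      exact mul_le_of_le_one_of_le ((W.valuation_le_one_iff _).2 (hW r)) hb
  refine ⟨a, hS ▸ Submodule.subset_span haS, ?_, hle⟩
  rintro rfl
  refine hJ0 ((Submodule.eq_bot_iff _).2 fun b hb => ?_)
  have := hle b hb
  rw [map_zero, map_zero, le_zero_iff, map_eq_zero] at this
  exact IsFractionRing.injective A K (this.trans (map_zero _).symm)

theorem affineBlowup_subset_valuationSubring {A : Type*} [CommRing A] {K : Type*} [Field K]
    [Algebra A K] [IsFractionRing A K] (W : ValuationSubring K)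
    (hW : ∀ s : A, algebraMap A K s ∈ W) {J : Ideal A} {a : A} (ha : a ≠ 0)
    (hle : ∀ b ∈ J, W.valuation (algebraMap A K b) ≤ W.valuation (algebraMap A K a))
    {z : K} (hz : z ∈ affineBlowup K J a) : z ∈ W := by
  have haK : algebraMap A K a ≠ 0 := fun h =>
    ha (IsFractionRing.injective A K (h.trans (map_zero _).symm))
  induction hz using Algebra.adjoin_induction with
  | mem z hz =>
    obtain ⟨b, hb, rfl⟩ := hz
    rw [← W.valuation_le_one_iff, map_div₀]
    exact div_le_one_of_le₀ (hle b hb) zero_le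
  | algebraMap r => exact hW r
  | add _ _ _ _ h1 h2 => exact add_mem h1 h2
  | mul _ _ _ _ h1 h2 => exact mul_mem h1 h2

/-- Every minimal prime of a nonzero ideal of a Noetherian domain is the center of a Rees
valuation of the ideal. -/
theorem exists_reesValuationRing_isCenter {A : Type*} [CommRing A] [IsDomain A]
    [IsNoetherianRing A] {K : Type*} [Field K] [Algebra A K] [IsFractionRing A K] {J P : Ideal A}
    (hJ0 : J ≠ ⊥) (hP : P ∈ J.minimalPrimes) :
    ∃ V ∈ reesValuationRings K J, IsCenter V P := by
  have hPp : P.IsPrime := hP.1.1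
  obtain ⟨W, hWA, hWP⟩ := exists_valuationSubring_isCenter (K := K) P
  obtain ⟨a, haJ, ha0, hle⟩ := exists_forall_valuation_le W hWA (IsNoetherian.noetherian J) hJ0
  have haK : algebraMap A K a ≠ 0 := fun h =>
    ha0 (IsFractionRing.injective A K (h.trans (map_zero _).symm))
  let C := affineBlowup K J a
  have : IsNoetherianRing C := isNoetherianRing_affineBlowup J a
  have : IsFractionRing C K := isFractionRing_subalgebra C
  let g : C →+* W := (algebraMap C K).codRestrict W
    fun c => affineBlowup_subset_valuationSubring W hWA ha0 hle c.2
  let q₀ : Ideal C := (maximalIdeal W).comap g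
  have hq₀ : q₀.comap (algebraMap A C) = P := Ideal.ext fun s => by
    rw [hWP, Ideal.mem_comap, Ideal.mem_comap, ← ValuationSubring.coe_mem_nonunits_iff]
    rfl
  have haq₀ : Ideal.span {algebraMap A C a} ≤ q₀ := by
    rw [Ideal.span_singleton_le_iff_mem, ← Ideal.mem_comap, hq₀]
    exact hP.1.2 haJ
  -- The center `q₀` of `W` may have height above one, so it is replaced by a minimal prime of `aC`
  -- below it.
  obtain ⟨q, hq, hqq₀⟩ := Ideal.exists_minimalPrimes_le haq₀
  have hqp : q.IsPrime := hq.1.1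
  have haq : algebraMap A C a ∈ q := hq.1.2 (Ideal.mem_span_singleton_self _)
  have hJq : J ≤ q.comap (algebraMap A C) := fun b hb => by
    have : algebraMap A C b = ⟨algebraMap A K b / algebraMap A K a,
        Algebra.subset_adjoin ⟨b, hb, rfl⟩⟩ * algebraMap A C a := Subtype.ext <| by
      change algebraMap A K b = algebraMap A K b / algebraMap A K a * algebraMap A K a
      field_simp
    rw [Ideal.mem_comap, this]
    exact q.mul_mem_left _ haq
  have hqP : q.comap (algebraMap A C) = P := by
    have hle : q.comap (algebraMap A C) ≤ P := hq₀ ▸ Ideal.comap_mono hqq₀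
    exact le_antisymm hle (hP.2 ⟨inferInstance, hJq⟩ hle)
  have hheight : q.height = 1 := by
    refine le_antisymm (Ideal.height_le_one_of_isPrincipal_of_mem_minimalPrimes _ q hq) ?_
    rw [Order.one_le_iff_ne_zero, Ne, Ideal.height_eq_zero_iff_eq_bot]
    intro h
    rw [h, Ideal.mem_bot] at haq
    exact haK (congrArg (algebraMap C K) haq)
  obtain ⟨V, hVdvr, Q, hQp, hQ1, hQq, hV⟩ :=
    exists_discreteValuationRing_of_height_eq_one (K := K) q hheight
  have hmem : ∀ s : A, algebraMap C (integralClosure C K) (algebraMap A C s) ∈ Q ↔ s ∈ P :=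
    fun s => by rw [← Ideal.mem_comap, hQq, ← Ideal.mem_comap, hqP]
  refine ⟨V, ⟨hVdvr, a, haJ, ha0, Q, hQp, hQ1, fun b hb => (hmem b).2 (hP.1.2 hb), hV⟩,
    fun s => ?_, fun s => ?_⟩
  · rw [← SetLike.mem_coe, hV]
    exact ⟨algebraMap C _ (algebraMap A C s), 1, fun h => hQp.ne_top ((Ideal.eq_top_iff_one _).2 h),
      by simp⟩
  · rw [← hmem, ← mem_nonunits_iff_of_eq hV]
    rfl

/-! ### Nonmaximal minimal primes and the conclusion. -/

/-- A ring of positive dimension modulo an ideal has a nonmaximal minimal prime over the ideal. -/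
theorem exists_minimalPrimes_not_isMaximal {A : Type*} [CommRing A] {J : Ideal A}
    (h : 0 < ringKrullDim (A ⧸ J)) : ∃ P ∈ J.minimalPrimes, ¬ P.IsMaximal := by
  by_contra! hmax
  refine h.not_ge (Ring.krullDimLE_iff.1 (Ring.KrullDimLE.mk₀ fun P hP => ?_))
  have hJ : J ≤ P.comap (Ideal.Quotient.mk J) := by
    intro b hb
    rw [Ideal.mem_comap, Ideal.Quotient.eq_zero_iff_mem.2 hb]
    exact P.zero_mem
  obtain ⟨P', hP', hle⟩ := Ideal.exists_minimalPrimes_le hJ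
  have : P'.IsMaximal := hmax P' hP'
  have heq := this.eq_of_le (Ideal.IsPrime.ne_top inferInstance) hle
  rw [heq] at this
  have h2 := Ideal.map_eq_top_or_isMaximal_of_surjective (Ideal.Quotient.mk J)
    Ideal.Quotient.mk_surjective this
  rw [Ideal.map_comap_of_surjective _ Ideal.Quotient.mk_surjective] at h2
  exact h2.resolve_left hP.ne_top

theorem firstTransform_ne_bot {R : Type*} [CommRing R] [IsLocalRing R] (K : Type*) [Field K]
    [Algebra R K] [IsFractionRing R K] (x : R) {I : Ideal R} (hI : I ≠ ⊥) :
    firstTransform K x I ≠ ⊥ := by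
  obtain ⟨i, hi, hi0⟩ := Submodule.exists_mem_ne_zero_of_ne_bot hI
  intro h
  have hmem : algebraMap R (firstBlowup K x) i ∈ firstTransform K x I := by
    rw [mem_firstTransform]
    exact Ideal.mul_mem_left _ _ (Ideal.mem_map_of_mem _ hi)
  rw [h, Ideal.mem_bot] at hmem
  exact hi0 (IsFractionRing.injective R K
    ((congrArg (algebraMap (firstBlowup K x) K) hmem).trans (map_zero _).symm))

end ReesVal

theorem proposition2p60 {R : Type*} [CommRing R] [IsRegularLocalRing R]
    [Infinite (IsLocalRing.ResidueField R)]
    {K : Type*} [Field K] [Algebra R K] [IsFractionRing R K]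
    (d : ℕ) (hd : 0 < d) (hdim : ringKrullDim R = d)
    (I : Ideal R) (hI : I.radical = IsLocalRing.maximalIdeal R)
    (x : R) (hx : x ∈ IsLocalRing.maximalIdeal R) (hx2 : x ∉ IsLocalRing.maximalIdeal R ^ 2)
    (hxV : ∀ V ∈ ReesVal.reesValuationRings K I,
      Submodule.span V {algebraMap R K x} =
        Submodule.span V (algebraMap R K '' (IsLocalRing.maximalIdeal R : Set R)))
    (hcenter : ∀ V ∈ ReesVal.reesValuationRings K I,
      ∃ M : Ideal (ReesVal.firstBlowup K x), M.IsMaximal ∧ ReesVal.IsCenter V M)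
    (hpos : 0 < ringKrullDim
      (ReesVal.firstBlowup K x ⧸ ReesVal.firstTransform K x I)) :
    ∃ V ∈ ReesVal.reesValuationRings K (ReesVal.firstTransform K x I),
      V ∉ ReesVal.reesValuationRings K I := by
  have : IsDomain R := (IsFractionRing.injective R K).isDomain
  have : IsFractionRing (ReesVal.firstBlowup K x) K := ReesVal.isFractionRing_subalgebra _
  have : IsNoetherianRing (ReesVal.firstBlowup K x) := ReesVal.isNoetherianRing_affineBlowup _ x
  -- If `I = 0`, then the maximal ideal is zero and `x = 0` lies in its square.
  have hI0 : I ≠ ⊥ := by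
    rintro rfl
    rw [Ideal.radical_bot_of_isReduced] at hI
    rw [← hI, Ideal.mem_bot] at hx
    exact hx2 (hx ▸ Ideal.zero_mem _)
  obtain ⟨P, hP, hPmax⟩ := ReesVal.exists_minimalPrimes_not_isMaximal hpos
  obtain ⟨V, hV, hVP⟩ := ReesVal.exists_reesValuationRing_isCenter (K := K)
    (ReesVal.firstTransform_ne_bot K x hI0) hP
  refine ⟨V, hV, fun hVI => ?_⟩
  obtain ⟨M, hM, hVM⟩ := hcenter V hVI
  exact hPmax (hVP.eq hVM ▸ hM)
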